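/- Let $(d_i)_{i\ge 1}$ be a sequence of positive integers, and let $\alpha=[0;1+d_1,d_2,d_3,\ldots]$. For an irrational $\gamma\in(0,1)$ let $c_\gamma$ be the characteristic Sturmian word of slope $\gamma$ over $\{a,b\}$, whose $m$-th letter ($m\ge 0$) is $a$ if $\lfloor (m+2)\gamma\rfloor-\lfloor (m+1)\gamma\rfloor=0$ and $b$ otherwise. Define words $s_{-1}=b$, $s_0=a$, $s_n=s_{n-1}^{d_n}s_{n-2}$ for $n\ge 1$. Computing in the free group on $\{a,b\}$, set $w_n=as_nb^{-1}$ for odd $n\ge 0$ and $w_n=bs_na^{-1}$ for even $n\ge 0$; set $v_n=as_{n+1}^{d_{n+2}-1}s_nb^{-1}$ for odd $n\ge -1$ and $v_n=bs_{n+1}^{d_{n+2}-1}s_na^{-1}$ for even $n\ge -1$; and let $w_{-1}=a$, $w_{-2}=v_{-2}=\varepsilon$. For $n\ge 0$ and $k\ge -1$ put $$U_{n,k}=(w_{n-1}v_{n-2})^kw_{n-1},\qquad \overline U_{n,k}=(v_{n-2}w_{n-1})^kv_{n-2},$$ so that $U_{n,-1}=v_{n-2}^{-1}$ and $\overline U_{n,-1}=w_{n-1}^{-1}$.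 Let $n\ge 1$ and $0\le k\le d_{n+1}-1$, and let $\alpha_{n,1-k}=[0;d_{n+1}+1-k,d_{n+2},d_{n+3},\ldots]$. Then $\overline U_{n,k}$ is a word, and $$c_\alpha=\Big(\prod_{j=-1}^{n-3}v_j\Big)\overline U_{n,k}^{(1)}z_1\overline U_{n,k}^{(2)}z_2\overline U_{n,k}^{(3)}z_3\cdots,$$ where $\overline U_{n,k}^{(i)}$ is the $i$-th occurrence of $\overline U_{n,k}$ in $c_\alpha$ and $z_1z_2z_3\cdots$ is obtained from $c_{\alpha_{n,1-k}}$ by replacing the letters $a$ and $b$ by $(\overline U_{n,k-1})^{-1}$ and $(U_{n-1,d_n-2})^{-1}$, respectively. That is, for every $i\ge 1$ the element $q_i=\big(\prod_{j=-1}^{n-3}v_j\big)\overline U_{n,k}z_1\overline U_{n,k}z_2\cdots\overline U_{n,k}z_{i-1}$ of the free group is a word, $q_i\overline U_{n,k}$ is a prefix of $c_\alpha$, and the $i$-th occurrence of $\overline U_{n,k}$ in $c_\alpha$ begins at position $|q_i|$. In particular, this locates all occurrences of $\overline U_{n,k}$ in $c_\alpha$. -/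

import Mathlib

open Filter Topology

namespace Sturmian

/-- The alphabet `{a, b}`. -/
inductive Letter
  | a
  | b

open Classical in
/-- The Sturmian word `s_{γ,ρ}`: its `m`-th letter is `a` if
`⌊(m+1)γ + ρ⌋ - ⌊mγ + ρ⌋ = 0`, and `b` otherwise. -/
noncomputable def lowerWord (γ ρ : ℝ) (m : ℕ) : Letter :=
  if ⌊((m : ℝ) + 1) * γ + ρ⌋ - ⌊(m : ℝ) * γ + ρ⌋ = 0 then Letter.a else Letter.b

/-- The characteristic word `c_γ`, which is `s_{γ,0} = a c_γ` with its first letter removed. -/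
noncomputable def charWord (γ : ℝ) (m : ℕ) : Letter :=
  lowerWord γ 0 (m + 1)

/-- The formal continued fraction `[0; x 0, x 1, x 2, …]`. -/
noncomputable def contFrac (x : ℕ → ℤ) : GenContFract ℝ :=
  ⟨0, Stream'.Seq.ofStream (fun i => (⟨1, (x i : ℝ)⟩ : GenContFract.Pair ℝ))⟩

/-- `γ = [0; x 0, x 1, x 2, …]`, an infinite continued fraction with positive integer
partial quotients: its convergents tend to `γ`. -/
def IsContFrac (γ : ℝ) (x : ℕ → ℤ) : Prop :=
  (∀ i, 1 ≤ x i) ∧ Tendsto (contFrac x).convs atTop (𝓝 γ)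

/-- The sequence `a_{n+1} + k, a_{n+2}, a_{n+3}, …`, where `x i = a_{i+1}`. If
`γ = [0; a_1, a_2, …]`, then these are the partial quotients of the number `γ_{n,k}`. -/
def shiftQuot (x : ℕ → ℤ) (n : ℕ) (k : ℤ) (i : ℕ) : ℤ :=
  if i = 0 then x n + k else x (n + i)

/-- The partial quotients `1 + d_1, d_2, d_3, …` attached to a directive sequence
`(d_1, d_2, d_3, …)`; the value `d 0` is never used. -/
def quot (d : ℕ → ℕ) (i : ℕ) : ℤ :=
  if i = 0 then 1 + (d 1 : ℤ) else (d (i + 1) : ℤ)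

/-- A letter as an element of the free group on `{a, b}`. -/
def ltr (x : Letter) : FreeGroup Letter := FreeGroup.of x

/-- The embedding of the free monoid of words into the free group. -/
def ofWord (u : List Letter) : FreeGroup Letter := (u.map ltr).prod

/-- `stdAux d m = s_{m-1}`. -/
def stdAux (d : ℕ → ℕ) : ℕ → FreeGroup Letter
  | 0 => ltr Letter.b
  | 1 => ltr Letter.a
  | m + 2 => stdAux d (m + 1) ^ d (m + 1) * stdAux d m

/-- The standard sequence `s_{-1} = b`, `s_0 = a`, `s_n = s_{n-1}^{d_n} s_{n-2}` (for `n ≥ -1`). -/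
def std (d : ℕ → ℕ) (n : ℤ) : FreeGroup Letter := stdAux d (n + 1).toNat

/-- The singular words `w_n`: `a s_n b⁻¹` for odd `n` and `b s_n a⁻¹` for even `n`, where `n ≥ 0`,
with the conventions `w_{-1} = a` and `w_{-2} = ε`. -/
def sing (d : ℕ → ℕ) (n : ℤ) : FreeGroup Letter :=
  if n ≤ -2 then 1
  else if n = -1 then ltr Letter.a
  else if Odd n then ltr Letter.a * std d n * (ltr Letter.b)⁻¹
  else ltr Letter.b * std d n * (ltr Letter.a)⁻¹

/-- The adjoining singular words `v_n`: `a s_{n+1}^{d_{n+2}-1} s_n b⁻¹` for odd `n` and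
`b s_{n+1}^{d_{n+2}-1} s_n a⁻¹` for even `n`, where `n ≥ -1`, with the convention `v_{-2} = ε`. -/
def adj (d : ℕ → ℕ) (n : ℤ) : FreeGroup Letter :=
  if n ≤ -2 then 1
  else if Odd n then
    ltr Letter.a * std d (n + 1) ^ ((d (n + 2).toNat : ℤ) - 1) * std d n * (ltr Letter.b)⁻¹
  else
    ltr Letter.b * std d (n + 1) ^ ((d (n + 2).toNat : ℤ) - 1) * std d n * (ltr Letter.a)⁻¹

/-- `U_{n,k} = (w_{n-1} v_{n-2})^k w_{n-1}`. As an identity in the free group, the formula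
for `k = -1` gives the convention `U_{n,-1} = (v_{n-2})⁻¹`. -/
def palU (d : ℕ → ℕ) (n k : ℤ) : FreeGroup Letter :=
  (sing d (n - 1) * adj d (n - 2)) ^ k * sing d (n - 1)

/-- `Ū_{n,k} = (v_{n-2} w_{n-1})^k v_{n-2}`. As an identity in the free group, the formula
for `k = -1` gives the convention `Ū_{n,-1} = (w_{n-1})⁻¹`. -/
def palUbar (d : ℕ → ℕ) (n k : ℤ) : FreeGroup Letter :=
  (adj d (n - 2) * sing d (n - 1)) ^ k * adj d (n - 2)

/-- The ordered product of the first `m` of the words `v_{-1}, v_0, v_1, …`, which is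
`v_{-1} v_0 ⋯ v_{m-2}`. -/
def adjProd (d : ℕ → ℕ) (m : ℕ) : FreeGroup Letter :=
  ((List.range m).map (fun j => adj d ((j : ℤ) - 1))).prod

/-- The sequence `x{g, h}` obtained from the infinite word `x` by replacing `a` by `g`
and `b` by `h`. -/
def overAlphabet (x : ℕ → Letter) (g h : FreeGroup Letter) (i : ℕ) : FreeGroup Letter :=
  match x i with
  | Letter.a => g
  | Letter.b => h

/-- The finite word `u` occurs at position `m` of the infinite word `x`. -/
def OccursAt (x : ℕ → Letter) (u : List Letter) (m : ℕ) : Prop :=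
  ∀ (j : ℕ) (hj : j < u.length), x (m + j) = u[j]

/-- `x = p u⁽¹⁾ z 0 u⁽²⁾ z 1 u⁽³⁾ z 2 ⋯`, where `u⁽ⁱ⁾` is the `i`-th occurrence of the word `u`
in `x`, and where `p`, `u` and the `z i` are given as elements of the free group (a `z i` may be the
inverse of a word, in which case two successive occurrences overlap). That is: `u` is a
word and, for each `i`, the element `q = p u (z 0) u (z 1) ⋯ u (z (i-1))` is a word, `q u` is a
prefix of `x`, and the occurrence of `u` after `q` is preceded by exactly `i` occurrences. -/
def IsOccDecomp (x : ℕ → Letter) (p u : FreeGroup Letter) (z : ℕ → FreeGroup Letter) : Prop :=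
  ∃ U : List Letter, ofWord U = u ∧ ∀ i : ℕ, ∃ q : List Letter,
    ofWord q = p * ((List.range i).map (fun j => u * z j)).prod ∧
    OccursAt x (q ++ U) 0 ∧
    {m : ℕ | m < q.length ∧ OccursAt x U m}.ncard = i

end Sturmian

namespace Sturmian

/-! ### Continued fractions -/

/-! Let q_n be the length of s_n and p_n the number of letters b in it (`den`, `num`). With the
index lowered by one, Ū_{n+1,k} is the factor of c_α of length (k+1) q_{n+1} - q_n at position q_n -
1. The vectors u = (q_{n+1}, p_{n+1}) and v = (k q_{n+1} + q_n, k p_{n+1} + p_n) form a basis of ℤ²,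
and up to a common sign q α - p takes values -μ at u and ν at v, with μ, ν > 0. Letters of c_α are
increments of ⌊z α⌋, so the factor recurs after a shift t iff, for some integer p, the signed value
of t α - p lies in the window (-ν, μ) (`window_of_floor`, `floor_congr_window`).

The point A u + B v has its value in the window iff B = ⌊(A + B + 1) β⌋ with β = μ / (μ + ν)
(`window_iff`). Hence successive returns are steps u and v in the order of the letters a and b of
c_β, and the recursion for the approximation errors yields the continued fraction of β
(`isContFrac_retSlope`).

It remains to read off the words. The prefix of length q_n is s_n (`pre_den`), and the two return
words are conjugates, by s_n without its last letter, of s_{n+1} and s_{n+1}^k s_n. In the free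
group the singular words are expressed through these truncations (`trunc`), which gives the same two
elements for Ū z (`palUbar_mul_inv_palUbar`, `palUbar_mul_inv_palU`). -/

lemma contFrac_convs_succ {x : ℕ → ℤ} (hx : ∀ i, 1 ≤ x i) (m : ℕ) :
    (contFrac x).convs (m + 1) = 1 / ((x 0 : ℝ) + (contFrac fun i => x (i + 1)).convs m) := by
  -- `convs` comes from the continuant recurrence, which extends at the far end; `convs'` unfolds
  -- from the front. They agree because the entries are positive.
  have key : ∀ (y : ℕ → ℤ), (∀ i, 1 ≤ y i) → ∀ m,
      (contFrac y).convs m = (contFrac y).convs' m := by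
    intro y hy m
    refine GenContFract.convs_eq_convs' fun {gp j} _ h => ?_
    have h' : (⟨1, (y j : ℝ)⟩ : GenContFract.Pair ℝ) = gp := by
      have : (some ⟨1, (y j : ℝ)⟩ : Option (GenContFract.Pair ℝ)) = some gp := h
      exact Option.some.inj this
    subst h'
    exact ⟨one_pos, Int.cast_pos.2 (hy j)⟩
  rw [key x hx, key _ fun i => hx (i + 1)]
  have hh : (contFrac x).s.head = some ⟨1, (x 0 : ℝ)⟩ := rfl
  have ht : (contFrac x).s.tail = (contFrac fun i => x (i + 1)).s := rfl
  simp only [GenContFract.convs']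
  rw [GenContFract.convs'Aux_succ_some hh, ht]
  simp [contFrac]

lemma contFrac_convs_mem {x : ℕ → ℤ} (hx : ∀ i, 1 ≤ x i) (m : ℕ) :
    0 ≤ (contFrac x).convs m ∧ (contFrac x).convs m ≤ 1 := by
  induction m generalizing x with
  | zero => simp [contFrac]
  | succ m ih =>
    have h := ih (x := fun i => x (i + 1)) fun i => hx (i + 1)
    have h0 : (1 : ℝ) ≤ x 0 := by exact_mod_cast hx 0
    rw [contFrac_convs_succ hx]
    constructor
    · apply one_div_nonneg.2; linarith [h.1]
    · rw [div_le_one (by linarith [h.1])]; linarith [h.1]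

namespace IsContFrac

variable {γ : ℝ} {x : ℕ → ℤ}

lemma nonneg (h : IsContFrac γ x) : 0 ≤ γ :=
  ge_of_tendsto' h.2 fun m => (contFrac_convs_mem h.1 m).1

lemma pos (h : IsContFrac γ x) : 0 < γ := by
  have h0 : (1 : ℝ) ≤ x 0 := by exact_mod_cast h.1 0
  have : 1 / ((x 0 : ℝ) + 1) ≤ γ := by
    refine ge_of_tendsto' ((tendsto_add_atTop_iff_nat 1).2 h.2) fun m => ?_
    have hm := contFrac_convs_mem (x := fun i => x (i + 1)) (fun i => h.1 (i + 1)) m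
    rw [contFrac_convs_succ h.1]
    exact one_div_le_one_div_of_le (by linarith [hm.1]) (by linarith [hm.2])
  exact lt_of_lt_of_le (by positivity) this

lemma tail (h : IsContFrac γ x) : IsContFrac (1 / γ - x 0) fun i => x (i + 1) := by
  refine ⟨fun i => h.1 (i + 1), ?_⟩
  have h1 := (tendsto_const_nhds (x := (1 : ℝ))).div
    ((tendsto_add_atTop_iff_nat 1).2 h.2) h.pos.ne'
  refine (h1.sub_const (x 0 : ℝ)).congr fun m => ?_
  simp only [Pi.div_apply]
  rw [contFrac_convs_succ h.1, one_div_one_div, add_sub_cancel_left]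

lemma cons {a : ℤ} (ha : 1 ≤ a) (h : IsContFrac γ x) :
    IsContFrac (1 / (a + γ)) fun i => if i = 0 then a else x (i - 1) := by
  have hy : ∀ i, 1 ≤ (fun i => if i = 0 then a else x (i - 1)) i := by
    intro i; by_cases hi : i = 0
    · simp [hi, ha]
    · simpa [hi] using h.1 (i - 1)
  refine ⟨hy, ?_⟩
  have ha' : (1 : ℝ) ≤ a := by exact_mod_cast ha
  have h1 : Tendsto (fun m => 1 / ((a : ℝ) + (contFrac x).convs m)) atTop (𝓝 (1 / (a + γ))) :=
    (tendsto_const_nhds (x := (1 : ℝ))).div (h.2.const_add (a : ℝ)) (by linarith [h.nonneg])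
  refine (tendsto_add_atTop_iff_nat 1).1 (h1.congr fun m => ?_)
  rw [contFrac_convs_succ hy]
  simp

lemma lt_one (h : IsContFrac γ x) : γ < 1 := by
  have h0 : (1 : ℝ) ≤ x 0 := by exact_mod_cast h.1 0
  have h1 : 1 < 1 / γ := by linarith [h.tail.pos]
  rw [lt_div_iff₀ h.pos] at h1
  linarith

/-- Irrationality by descent: N γ = r forces r < N, and r (1/γ - x 0) = N - r x 0 is a relation of
the same kind for the tail. -/
lemma int_mul_ne (h : IsContFrac γ x) (N : ℕ) (hN : 0 < N) (r : ℤ) : (N : ℝ) * γ ≠ r := by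
  induction N using Nat.strong_induction_on generalizing γ x r with
  | _ N ih =>
    intro hr
    have hN' : (0 : ℝ) < N := by exact_mod_cast hN
    have hr0 : (0 : ℝ) < r := by rw [← hr]; exact mul_pos hN' h.pos
    have hr1 : (r : ℝ) < N := by rw [← hr]; nlinarith [h.lt_one]
    have hr0' : 0 < r := by exact_mod_cast hr0
    lift r to ℕ using hr0'.le
    have hlt : r < N := by exact_mod_cast hr1
    refine ih r hlt h.tail (by exact_mod_cast hr0') (N - r * x 0) ?_
    have hg := h.pos.ne'
    push_cast at hr ⊢
    rw [← hr]
    field_simp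

end IsContFrac

/-- The complete quotients of `[0; x 0, x 1, …]`, inverted. -/
noncomputable def gaussIter (γ : ℝ) (x : ℕ → ℤ) : ℕ → ℝ
  | 0 => γ
  | n + 1 => 1 / gaussIter γ x n - x n

lemma IsContFrac.gaussIter {γ : ℝ} {x : ℕ → ℤ} (h : IsContFrac γ x) (n : ℕ) :
    IsContFrac (gaussIter γ x n) fun i => x (n + i) := by
  induction n with
  | zero => simpa [Sturmian.gaussIter] using h
  | succ n ih =>
    have := ih.tail
    simp only [add_zero] at this
    have e : (fun i => x (n + 1 + i)) = fun i => x (n + (i + 1)) :=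
      funext fun i => congrArg x (by omega)
    rw [e]
    exact this

/-! ### Convergents -/

/-- The length of `s_n`. -/
def den (d : ℕ → ℕ) : ℕ → ℕ
  | 0 => 1
  | 1 => d 1 + 1
  | n + 2 => d (n + 2) * den d (n + 1) + den d n

/-- The number of letters `b` in `s_n`. -/
def num (d : ℕ → ℕ) : ℕ → ℕ
  | 0 => 0
  | 1 => 1
  | n + 2 => d (n + 2) * num d (n + 1) + num d n

/-- The signed approximation error `(-1)^n (q_n α - p_n)`. -/
noncomputable def err (d : ℕ → ℕ) (α : ℝ) (n : ℕ) : ℝ :=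
  (-1) ^ n * (den d n * α - num d n)

lemma err_add_two (d : ℕ → ℕ) (α : ℝ) (n : ℕ) :
    err d α (n + 2) = err d α n - d (n + 2) * err d α (n + 1) := by
  simp only [err, den, num]; push_cast; ring

lemma quot_succ (d : ℕ → ℕ) (n : ℕ) : quot d (n + 1) = d (n + 2) := by simp [quot]

lemma den_pos (d : ℕ → ℕ) : ∀ n, 1 ≤ den d n
  | 0 => le_rfl
  | 1 => by simp [den]
  | n + 2 => by have := den_pos d n; simp only [den]; omega

lemma den_lt_den_succ {d : ℕ → ℕ} (hd : ∀ i, 1 ≤ i → 1 ≤ d i) (n : ℕ) :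
    den d n < den d (n + 1) := by
  cases n with
  | zero => have := hd 1 le_rfl; simp only [den]; omega
  | succ n =>
    have h1 := hd (n + 2) (by omega)
    have h2 := den_pos d n
    simp only [den]
    nlinarith

lemma two_le_den {d : ℕ → ℕ} (hd : ∀ i, 1 ≤ i → 1 ≤ d i) (n : ℕ) : 2 ≤ den d (n + 1) := by
  have := den_lt_den_succ hd n
  have := den_pos d n
  omega

lemma det_den_num (d : ℕ → ℕ) (n : ℕ) :
    (den d n : ℤ) * num d (n + 1) - den d (n + 1) * num d n = (-1) ^ n := by
  induction n with
  | zero => simp [den, num]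
  | succ n ih =>
    simp only [den, num]
    push_cast
    rw [pow_succ, ← ih]; ring

lemma err_zero (d : ℕ → ℕ) (α : ℝ) : err d α 0 = α := by simp [err, den, num]

section

variable {d : ℕ → ℕ} {α : ℝ}

/-- The errors and the complete quotients obey the same recursion; positivity and strict decrease of
the errors follow. -/
lemma err_succ (hα : IsContFrac α (quot d)) (n : ℕ) :
    err d α (n + 1) = gaussIter α (quot d) (n + 1) * err d α n := by
  induction n with
  | zero =>
    have := hα.pos.ne'
    simp only [err, den, num, gaussIter, quot]
    push_cast
    field_simp
    simp
    ring
  | succ n ih =>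
    have := (hα.gaussIter (n + 1)).pos.ne'
    rw [err_add_two]
    conv_rhs => rw [gaussIter, quot_succ, ih]
    rw [ih]
    push_cast
    field_simp

lemma err_pos (hα : IsContFrac α (quot d)) (n : ℕ) : 0 < err d α n := by
  induction n with
  | zero => rw [err_zero]; exact hα.pos
  | succ n ih => rw [err_succ hα]; exact mul_pos (hα.gaussIter (n + 1)).pos ih

lemma err_succ_lt (hα : IsContFrac α (quot d)) (n : ℕ) : err d α (n + 1) < err d α n := by
  rw [err_succ hα]
  nlinarith [err_pos hα n, (hα.gaussIter (n + 1)).lt_one]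

lemma err_le (hα : IsContFrac α (quot d)) (n : ℕ) : err d α n ≤ α := by
  induction n with
  | zero => rw [err_zero]
  | succ n ih => exact (err_succ_lt hα n).le.trans ih

lemma two_mul_lt_one (hd : ∀ i, 1 ≤ i → 1 ≤ d i) (hα : IsContFrac α (quot d)) : 2 * α < 1 := by
  have h := err_pos hα 1
  have h1 : (1 : ℝ) ≤ d 1 := by exact_mod_cast hd 1 le_rfl
  have : err d α 1 = 1 - (d 1 + 1) * α := by simp [err, den, num]
  nlinarith [hα.pos]

end

/-! ### Lattice bases adapted to a slope -/

/-- `(qu, pu)`, `(qv, pv)` is a basis of `ℤ²` such that `q α - p` has opposite signs, and absolute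
values `μ` and `ν`, at the two basis vectors. -/
structure IsApproxBasis (α s : ℝ) (qu pu qv pv : ℤ) (μ ν : ℝ) : Prop where
  sign : s = 1 ∨ s = -1
  left : s * (qu * α - pu) = -μ
  right : s * (qv * α - pv) = ν
  left_pos : 0 < μ
  right_pos : 0 < ν
  span : ∀ M r : ℤ, ∃ A B : ℤ, M = A * qu + B * qv ∧ r = A * pu + B * pv

/-- If the floors differed, the larger one would be an integer r separating x + y from x + y', and x
- r would lie in the forbidden range. -/
lemma floor_add_eq_floor_add {x y y' lo hi s : ℝ} (hs : s = 1 ∨ s = -1)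
    (hy : lo < s * y ∧ s * y < hi) (hy' : lo < s * y' ∧ s * y' < hi)
    (h : ∀ r : ℤ, -hi < s * (x - r) → s * (x - r) < -lo → False) :
    ⌊x + y⌋ = ⌊x + y'⌋ := by
  wlog hlt : ⌊x + y⌋ < ⌊x + y'⌋ generalizing y y'
  · rcases lt_trichotomy ⌊x + y⌋ ⌊x + y'⌋ with h1 | h1 | h1
    · exact this hy hy' h1
    · exact h1
    · exact (this hy' hy h1).symm
  · exfalso
    have h1 : x + y < ⌊x + y'⌋ := Int.floor_lt.1 hlt
    have h2 := Int.floor_le (x + y')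
    refine h ⌊x + y'⌋ ?_ ?_ <;> rcases hs with rfl | rfl <;> linarith [hy.1, hy.2, hy'.1, hy'.2]

namespace IsApproxBasis

variable {α s μ ν : ℝ} {qu pu qv pv : ℤ}

lemma eval (h : IsApproxBasis α s qu pu qv pv μ ν) (A B : ℤ) :
    s * (((A * qu + B * qv : ℤ) : ℝ) * α - (A * pu + B * pv : ℤ)) = B * ν - A * μ := by
  push_cast
  linear_combination (A : ℝ) * h.left + (B : ℝ) * h.right

/-- The floors at `M + t` and `M + t'` agree, up to `p - p'`, if no lattice point with first
coordinate `M` separates them. -/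
lemma floor_congr (h : IsApproxBasis α s qu pu qv pv μ ν) {M t t' p p' : ℤ} {lo hi : ℝ}
    (ht : lo < s * (t * α - p) ∧ s * (t * α - p) < hi)
    (ht' : lo < s * (t' * α - p') ∧ s * (t' * α - p') < hi)
    (hM : ∀ A B : ℤ, M = A * qu + B * qv → -hi < B * ν - A * μ → B * ν - A * μ < -lo → False) :
    ⌊((M + t : ℤ) : ℝ) * α⌋ - p = ⌊((M + t' : ℤ) : ℝ) * α⌋ - p' := by
  have key := floor_add_eq_floor_add (x := M * α) h.sign ht ht' fun r h1 h2 => by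
    obtain ⟨A, B, hA, hB⟩ := h.span M r
    have e := h.eval A B
    rw [← hA, ← hB] at e
    rw [e] at h1 h2
    exact hM A B hA h1 h2
  have e : ∀ t p : ℤ, ((M + t : ℤ) : ℝ) * α = M * α + (t * α - p) + p := by
    intro t p; push_cast; ring
  rw [e t p, e t' p', Int.floor_add_intCast, Int.floor_add_intCast, key]
  ring

lemma cases_AB (hu : 0 < qu) (hv : 0 < qv) {A B : ℤ} (hpos : 0 < A * qu + B * qv) :
    (1 ≤ A ∧ 1 ≤ B) ∨ (1 ≤ A ∧ B ≤ 0) ∨ (A ≤ 0 ∧ 1 ≤ B) := by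
  by_cases hA : 1 ≤ A <;> by_cases hB : 1 ≤ B
  · exact .inl ⟨hA, hB⟩
  · exact .inr (.inl ⟨hA, by omega⟩)
  · exact .inr (.inr ⟨by omega, hB⟩)
  · exfalso
    have h1 : A * qu ≤ 0 := mul_nonpos_of_nonpos_of_nonneg (by omega) hu.le
    have h2 : B * qv ≤ 0 := mul_nonpos_of_nonpos_of_nonneg (by omega) hv.le
    omega

lemma value_ge (h : IsApproxBasis α s qu pu qv pv μ ν) {A B : ℤ} (hA : A ≤ 0) (hB : 1 ≤ B) :
    ν ≤ B * ν - A * μ := by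
  have hA' : (A : ℝ) ≤ 0 := by exact_mod_cast hA
  have hB' : (1 : ℝ) ≤ B := by exact_mod_cast hB
  nlinarith [h.left_pos, h.right_pos]

lemma value_le (h : IsApproxBasis α s qu pu qv pv μ ν) {A B : ℤ} (hA : 1 ≤ A) (hB : B ≤ 0) :
    B * ν - A * μ ≤ -μ := by
  have hA' : (1 : ℝ) ≤ A := by exact_mod_cast hA
  have hB' : (B : ℝ) ≤ 0 := by exact_mod_cast hB
  nlinarith [h.left_pos, h.right_pos]

lemma add_le (hu : 0 < qu) (hv : 0 < qv) {A B : ℤ} (hA : 1 ≤ A) (hB : 1 ≤ B) :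
    qu + qv ≤ A * qu + B * qv := by nlinarith

/-- All times `t` whose value lies in the window `(-ν, μ)` see the same floors at distance
`M < qu + qv`. -/
lemma floor_congr_window (h : IsApproxBasis α s qu pu qv pv μ ν) (hu : 0 < qu) (hv : 0 < qv)
    {M t t' p p' : ℤ} (hM : 0 < M) (hM' : M < qu + qv)
    (ht : -ν < s * (t * α - p) ∧ s * (t * α - p) < μ)
    (ht' : -ν < s * (t' * α - p') ∧ s * (t' * α - p') < μ) :
    ⌊((M + t : ℤ) : ℝ) * α⌋ - p = ⌊((M + t' : ℤ) : ℝ) * α⌋ - p' := by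
  refine h.floor_congr ht ht' fun A B hAB h1 h2 => ?_
  -- Two positive coefficients make M too large; mixed ones push the value to at most -μ or at least
  -- ν.
  rcases cases_AB hu hv (hAB ▸ hM) with ⟨hA, hB⟩ | ⟨hA, hB⟩ | ⟨hA, hB⟩
  · have := add_le hu hv hA hB; omega
  · linarith [h.value_le hA hB]
  · linarith [h.value_ge hA hB]

/-- Admitting M = qu + qv adds one lattice point, u + v, of value ν - μ; the shortened window
excludes it. These are the values that stay in the full window after a step u. `floor_congr_right`
is the counterpart for a step v. -/
lemma floor_congr_left (h : IsApproxBasis α s qu pu qv pv μ ν) (hu : 0 < qu) (hv : 0 < qv)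
    {M t t' p p' : ℤ} (hM : 0 < M) (hM' : M ≤ qu + qv)
    (ht : μ - ν < s * (t * α - p) ∧ s * (t * α - p) < μ)
    (ht' : μ - ν < s * (t' * α - p') ∧ s * (t' * α - p') < μ) :
    ⌊((M + t : ℤ) : ℝ) * α⌋ - p = ⌊((M + t' : ℤ) : ℝ) * α⌋ - p' := by
  refine h.floor_congr ht ht' fun A B hAB h1 h2 => ?_
  rcases cases_AB hu hv (hAB ▸ hM) with ⟨hA, hB⟩ | ⟨hA, hB⟩ | ⟨hA, hB⟩
  · have h3 : A * qu + B * qv ≤ qu + qv := by omega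
    have hA1 : A = 1 := by nlinarith
    have hB1 : B = 1 := by nlinarith
    subst hA1 hB1
    push_cast at h2
    linarith
  · linarith [h.value_le hA hB]
  · linarith [h.value_ge hA hB, h.left_pos]

lemma floor_congr_right (h : IsApproxBasis α s qu pu qv pv μ ν) (hu : 0 < qu) (hv : 0 < qv)
    {M t t' p p' : ℤ} (hM : 0 < M) (hM' : M ≤ qu + qv)
    (ht : -ν < s * (t * α - p) ∧ s * (t * α - p) < μ - ν)
    (ht' : -ν < s * (t' * α - p') ∧ s * (t' * α - p') < μ - ν) :
    ⌊((M + t : ℤ) : ℝ) * α⌋ - p = ⌊((M + t' : ℤ) : ℝ) * α⌋ - p' := by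
  refine h.floor_congr ht ht' fun A B hAB h1 h2 => ?_
  rcases cases_AB hu hv (hAB ▸ hM) with ⟨hA, hB⟩ | ⟨hA, hB⟩ | ⟨hA, hB⟩
  · have h3 : A * qu + B * qv ≤ qu + qv := by omega
    have hA1 : A = 1 := by nlinarith
    have hB1 : B = 1 := by nlinarith
    subst hA1 hB1
    push_cast at h1
    linarith
  · linarith [h.value_le hA hB, h.right_pos]
  · linarith [h.value_ge hA hB]

/-- If `t` sees the same floors at the two basis vectors, its value lies in the window. -/
lemma window_of_floor (h : IsApproxBasis α s qu pu qv pv μ ν) (hμ : μ < 1) (hν : ν < 1)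
    {t p : ℤ} (hu : ⌊((qu + t : ℤ) : ℝ) * α⌋ - p = ⌊(qu : ℝ) * α⌋)
    (hv : ⌊((qv + t : ℤ) : ℝ) * α⌋ - p = ⌊(qv : ℝ) * α⌋)
    (hu' : ((qu + t : ℤ) : ℝ) * α ≠ (pu + p : ℤ)) (hv' : ((qv + t : ℤ) : ℝ) * α ≠ (pv + p : ℤ)) :
    -ν < s * (t * α - p) ∧ s * (t * α - p) < μ := by
  have hμ0 := h.left_pos
  have hν0 := h.right_pos
  have e1 := h.left
  have e2 := h.right
  have f1 := Int.floor_le (((qu + t : ℤ) : ℝ) * α)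
  have f2 := Int.lt_floor_add_one (((qu + t : ℤ) : ℝ) * α)
  have f3 := Int.floor_le (((qv + t : ℤ) : ℝ) * α)
  have f4 := Int.lt_floor_add_one (((qv + t : ℤ) : ℝ) * α)
  rw [show ⌊((qu + t : ℤ) : ℝ) * α⌋ = ⌊(qu : ℝ) * α⌋ + p by omega] at f1 f2
  rw [show ⌊((qv + t : ℤ) : ℝ) * α⌋ = ⌊(qv : ℝ) * α⌋ + p by omega] at f3 f4
  rcases h.sign with rfl | rfl
  · have g1 : ⌊(qu : ℝ) * α⌋ = pu - 1 := by
      rw [Int.floor_eq_iff]; push_cast; constructor <;> linarith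
    have g2 : ⌊(qv : ℝ) * α⌋ = pv := by
      rw [Int.floor_eq_iff]; constructor <;> linarith
    rw [g1] at f1 f2
    rw [g2] at f3 f4
    have f3' := lt_of_le_of_ne f3 hv'.symm
    push_cast at f1 f2 f3' f4
    constructor <;> linarith
  · have g1 : ⌊(qu : ℝ) * α⌋ = pu := by
      rw [Int.floor_eq_iff]; constructor <;> linarith
    have g2 : ⌊(qv : ℝ) * α⌋ = pv - 1 := by
      rw [Int.floor_eq_iff]; push_cast; constructor <;> linarith
    rw [g1] at f1 f2
    rw [g2] at f3 f4
    have f1' := lt_of_le_of_ne f1 hu'.symm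
    push_cast at f1' f2 f3 f4
    constructor <;> linarith

/-- The value `B ν - A μ` lies in the window iff `B` is the expected floor. -/
lemma window_iff (h : IsApproxBasis α s qu pu qv pv μ ν) {A B : ℤ}
    (hirr : (B : ℝ) * ν - A * μ ≠ μ) :
    (-ν < B * ν - A * μ ∧ B * ν - A * μ < μ) ↔ B = ⌊((A + B + 1 : ℤ) : ℝ) * (μ / (μ + ν))⌋ := by
  have hμ0 := h.left_pos
  have hν0 := h.right_pos
  have hpos : 0 < μ + ν := by positivity
  -- After clearing the denominator the two floor inequalities read Bν - Aμ ≤ μ and -ν < Bν - Aμ;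
  -- only the end μ needs `hirr`.
  rw [eq_comm, Int.floor_eq_iff, ← mul_div_assoc, le_div_iff₀ hpos, div_lt_iff₀ hpos]
  push_cast
  constructor
  · rintro ⟨h1, h2⟩; constructor <;> nlinarith
  · rintro ⟨h1, h2⟩
    have h3 : (B : ℝ) * ν - A * μ ≤ μ := by linarith
    exact ⟨by linarith, lt_of_le_of_ne h3 hirr⟩

end IsApproxBasis

/-! ### Factors of characteristic words -/

/-- The factor of length `l` of `x` at position `m`. -/
def seg (x : ℕ → Letter) (m l : ℕ) : List Letter := (List.range l).map fun j => x (m + j)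

@[simp] lemma length_seg (x : ℕ → Letter) (m l : ℕ) : (seg x m l).length = l := by simp [seg]

lemma seg_add (x : ℕ → Letter) (m l l' : ℕ) :
    seg x m (l + l') = seg x m l ++ seg x (m + l) l' := by
  simp [seg, List.range_add, Function.comp_def, add_assoc]

lemma seg_succ (x : ℕ → Letter) (m l : ℕ) : seg x m (l + 1) = seg x m l ++ [x (m + l)] := by
  simp [seg, List.range_succ]

lemma seg_eq_seg_iff (x : ℕ → Letter) (m m' l : ℕ) :
    seg x m l = seg x m' l ↔ ∀ j < l, x (m + j) = x (m' + j) := by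
  simp [seg]

lemma occursAt_seg_iff (x : ℕ → Letter) (m m' l : ℕ) :
    OccursAt x (seg x m' l) m ↔ seg x m l = seg x m' l := by
  rw [seg_eq_seg_iff]
  simp [OccursAt, seg]

lemma ofWord_append (u v : List Letter) : ofWord (u ++ v) = ofWord u * ofWord v := by
  simp [ofWord]

lemma ofWord_seg (x : ℕ → Letter) (m l : ℕ) :
    ofWord (seg x m l) = (ofWord (seg x 0 m))⁻¹ * ofWord (seg x 0 (m + l)) := by
  rw [seg_add, ofWord_append, zero_add, inv_mul_cancel_left]

/-- `⌊z α⌋`. -/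
noncomputable def flo (α : ℝ) (z : ℤ) : ℤ := ⌊(z : ℝ) * α⌋

lemma charWord_eq (α : ℝ) (m : ℕ) :
    charWord α m = if flo α (m + 1 + 1) - flo α (m + 1) = 0 then Letter.a else Letter.b := by
  simp [charWord, lowerWord, flo]

section

variable {α : ℝ}

lemma flo_succ (h0 : 0 < α) (h1 : α < 1) (z : ℤ) :
    flo α (z + 1) = flo α z ∨ flo α (z + 1) = flo α z + 1 := by
  have f1 := Int.floor_le ((z : ℝ) * α)
  have f2 := Int.lt_floor_add_one ((z : ℝ) * α)
  have e1 : flo α z ≤ flo α (z + 1) := Int.floor_le_floor (by push_cast; linarith)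
  have e2 : flo α (z + 1) < flo α z + 2 := by
    unfold flo
    rw [Int.floor_lt]; push_cast; linarith
  omega

lemma charWord_eq_a_iff (m : ℕ) :
    charWord α m = Letter.a ↔ flo α (m + 1 + 1) = flo α (m + 1) := by
  rw [charWord_eq]
  split_ifs with h
  · simp; omega
  · simp; omega

lemma charWord_eq_b_iff (h0 : 0 < α) (h1 : α < 1) (m : ℕ) :
    charWord α m = Letter.b ↔ flo α (m + 1 + 1) = flo α (m + 1) + 1 := by
  have := flo_succ h0 h1 (m + 1)
  rw [charWord_eq]
  split_ifs with h
  · simp; omega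
  · simp; omega

lemma charWord_eq_charWord_iff (h0 : 0 < α) (h1 : α < 1) (m m' : ℕ) :
    charWord α m = charWord α m' ↔
      flo α (m + 1 + 1) - flo α (m + 1) = flo α (m' + 1 + 1) - flo α (m' + 1) := by
  have e := flo_succ h0 h1 (m + 1)
  have e' := flo_succ h0 h1 (m' + 1)
  rw [charWord_eq, charWord_eq]
  split_ifs with h h' h' <;> simp <;> omega

lemma seg_charWord_eq_iff (h0 : 0 < α) (h1 : α < 1) (m m' l : ℕ) :
    seg (charWord α) m l = seg (charWord α) m' l ↔
      ∀ j : ℕ, j ≤ l → flo α (m + 1 + j) - flo α (m + 1) = flo α (m' + 1 + j) - flo α (m' + 1) := by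
  rw [seg_eq_seg_iff]
  simp only [charWord_eq_charWord_iff h0 h1]
  have c1 : ∀ m j : ℕ, ((m + j : ℕ) : ℤ) + 1 = m + 1 + j := by intro m j; push_cast; ring
  have c2 : ∀ m j : ℕ, (m : ℤ) + 1 + j + 1 = m + 1 + (j + 1 : ℕ) := by
    intro m j; push_cast; ring
  simp only [c1, c2]
  constructor
  · intro h j hj
    induction j with
    | zero => simp
    | succ j ih => have := h j (by omega); have := ih (by omega); omega
  · intro h j hj
    have := h j (by omega); have := h (j + 1) (by omega); omega

/-- The offsets p, p' are eliminated by the case j = 0, so only increments of the floors count. -/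
lemma seg_charWord_eq_of_flo (h0 : 0 < α) (h1 : α < 1) {m m' l : ℕ} {p p' : ℤ}
    (h : ∀ j : ℕ, j ≤ l → flo α (m + 1 + j) - p = flo α (m' + 1 + j) - p') :
    seg (charWord α) m l = seg (charWord α) m' l := by
  rw [seg_charWord_eq_iff h0 h1]
  intro j hj
  have e1 := h j hj
  have e2 := h 0 (by omega)
  simp only [Nat.cast_zero, add_zero] at e2
  omega

end

/-! ### Prefixes of the characteristic word -/

section

variable {d : ℕ → ℕ} {α : ℝ}

lemma isApproxBasis (hα : IsContFrac α (quot d)) {n k : ℕ} (hk : k < d (n + 2)) :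
    IsApproxBasis α ((-1) ^ n) (den d (n + 1)) (num d (n + 1)) (k * den d (n + 1) + den d n)
      (k * num d (n + 1) + num d n) (err d α (n + 1)) (err d α n - k * err d α (n + 1)) where
  sign := neg_one_pow_eq_or ℝ n
  left := by simp only [err]; push_cast; ring
  right := by simp only [err]; push_cast; ring
  left_pos := err_pos hα _
  right_pos := by
    have h := err_pos hα (n + 2)
    rw [err_add_two] at h
    have hk' : (k : ℝ) ≤ d (n + 2) := by exact_mod_cast hk.le
    nlinarith [err_pos hα (n + 1)]
  span M r := by
    have hdet := det_den_num d n
    have hsq : ((-1 : ℤ) ^ n) * (-1) ^ n = 1 := by rw [← mul_pow]; simp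
    set δ : ℤ := (-1) ^ n
    -- Cramer's rule: the determinant is -δ, which is its own inverse.
    refine ⟨-δ * (M * (k * num d (n + 1) + num d n) - r * (k * den d (n + 1) + den d n)),
      -δ * (den d (n + 1) * r - num d (n + 1) * M), ?_, ?_⟩
    · linear_combination (-M) * hsq - M * δ * hdet
    · linear_combination (-r) * hsq - r * δ * hdet

lemma isApproxBasis_zero (hd : ∀ i, 1 ≤ i → 1 ≤ d i) (hα : IsContFrac α (quot d)) (n : ℕ) :
    IsApproxBasis α ((-1) ^ n) (den d (n + 1)) (num d (n + 1)) (den d n) (num d n)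
      (err d α (n + 1)) (err d α n) := by
  simpa using isApproxBasis hα (n := n) (k := 0) (hd (n + 2) (by omega))

lemma flo_den_add (hd : ∀ i, 1 ≤ i → 1 ≤ d i) (hα : IsContFrac α (quot d)) {n : ℕ} {j : ℤ}
    (hj : 0 < j) (hj' : j < den d (n + 1)) : flo α (j + den d n) - num d n = flo α j := by
  have h := isApproxBasis_zero hd hα n
  have hμ := h.left_pos
  have hν := h.right_pos
  have hu : (0 : ℤ) < den d (n + 1) := by exact_mod_cast den_pos d (n + 1)
  have hv : (0 : ℤ) < den d n := by exact_mod_cast den_pos d n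
  -- The values compared are ν, at q_n, and 0; the interval (-μ, ν + μ) contains both.
  have key := h.floor_congr (M := j) (t := den d n) (t' := 0) (p := num d n) (p' := 0)
    (lo := -err d α (n + 1)) (hi := err d α n + err d α (n + 1))
    ⟨by rw [h.right]; linarith, by rw [h.right]; linarith⟩ ⟨by simp [hμ], by simp; positivity⟩ ?_
  · simpa [flo] using key
  · intro A B hAB h1 h2
    rcases IsApproxBasis.cases_AB hu hv (hAB ▸ hj) with ⟨hA, hB⟩ | ⟨hA, hB⟩ | ⟨hA, hB⟩
    · have := IsApproxBasis.add_le hu hv hA hB; omega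
    · have hB' : B ≤ -1 := by
        by_contra hc
        have : B = 0 := by omega
        subst this
        nlinarith
      have hA' : (1 : ℝ) ≤ A := by exact_mod_cast hA
      have hB'' : (B : ℝ) ≤ -1 := by exact_mod_cast hB'
      nlinarith
    · have := h.value_ge hA hB
      have := err_succ_lt hα n
      linarith

/-- The prefix of length `m` of the characteristic word, in the free group. -/
noncomputable def pre (α : ℝ) (m : ℕ) : FreeGroup Letter := ofWord (seg (charWord α) 0 m)

lemma pre_succ (α : ℝ) (m : ℕ) : pre α (m + 1) = pre α m * ltr (charWord α m) := by
  simp [pre, seg_succ, ofWord]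

lemma pre_den_add (hd : ∀ i, 1 ≤ i → 1 ≤ d i) (hα : IsContFrac α (quot d)) {n m : ℕ}
    (hm : m + 2 ≤ den d (n + 1)) : pre α (den d n + m) = pre α (den d n) * pre α m := by
  have : seg (charWord α) (den d n) m = seg (charWord α) 0 m := by
    refine seg_charWord_eq_of_flo hα.pos hα.lt_one (p := num d n) (p' := 0) fun j hj => ?_
    have := flo_den_add hd hα (n := n) (j := 1 + j) (by omega) (by omega)
    rw [show (den d n : ℤ) + 1 + j = 1 + j + den d n by ring, this]
    simp
  rw [pre, seg_add, ofWord_append, zero_add, this]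
  rfl

/-- The prefix of length q_{n+1} + q_n - 2 has period q_n, by repeated use of `pre_den_add`. -/
lemma pre_mul_den_add (hd : ∀ i, 1 ≤ i → 1 ≤ d i) (hα : IsContFrac α (quot d)) {n m : ℕ} (i : ℕ)
    (hm : i * den d n + m + 2 ≤ den d (n + 1) + den d n) :
    pre α (i * den d n + m) = pre α (den d n) ^ i * pre α m := by
  induction i with
  | zero => simp
  | succ i ih =>
    rw [add_mul, one_mul] at hm ⊢
    rw [show i * den d n + den d n + m = den d n + (i * den d n + m) by ring,
      pre_den_add hd hα (by omega), ih (by omega), pow_succ', mul_assoc]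

lemma charWord_eq_a_of_le (hα : IsContFrac α (quot d)) {m : ℕ} (hm : m < d 1) :
    charWord α m = Letter.a := by
  have h := err_pos hα 1
  have e : err d α 1 = 1 - (d 1 + 1) * α := by simp [err, den, num]
  have hz : ∀ z : ℤ, 0 ≤ z → z ≤ d 1 + 1 → flo α z = 0 := by
    intro z h0 h1
    have h0' : (0 : ℝ) ≤ z := by exact_mod_cast h0
    have h1' : (z : ℝ) ≤ d 1 + 1 := by exact_mod_cast h1
    have := hα.pos
    rw [flo, Int.floor_eq_zero_iff]
    constructor <;> nlinarith
  rw [charWord_eq_a_iff, hz _ (by omega) (by omega), hz _ (by omega) (by omega)]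

/-- The last letter of `s_n`. -/
def lastLetter (n : ℕ) : Letter := if Even n then Letter.a else Letter.b

lemma flo_den (hα : IsContFrac α (quot d)) (n : ℕ) :
    flo α (den d n) = if Even n then (num d n : ℤ) else num d n - 1 := by
  have h := err_pos hα n
  have h1 := err_le hα n
  have h2 := hα.lt_one
  unfold flo
  split_ifs with hn
  · rw [err, hn.neg_one_pow] at h h1
    rw [Int.floor_eq_iff]; push_cast; constructor <;> linarith
  · rw [err, (Nat.not_even_iff_odd.1 hn).neg_one_pow] at h h1
    rw [Int.floor_eq_iff]; push_cast; constructor <;> linarith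

lemma flo_den_succ (hd : ∀ i, 1 ≤ i → 1 ≤ d i) (hα : IsContFrac α (quot d)) (n : ℕ) :
    flo α (den d n + 1) = num d n := by
  have h := err_pos hα n
  have h1 := err_le hα n
  -- For even n the value q_n α - p_n is at most α, so adding a further α stays below 1.
  have h2 := two_mul_lt_one hd hα
  unfold flo
  rcases Nat.even_or_odd n with hn | hn
  · rw [err, hn.neg_one_pow] at h h1
    rw [Int.floor_eq_iff]; push_cast; constructor <;> linarith
  · rw [err, hn.neg_one_pow] at h h1
    rw [Int.floor_eq_iff]; push_cast; constructor <;> linarith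

lemma charWord_den_sub_one (hd : ∀ i, 1 ≤ i → 1 ≤ d i) (hα : IsContFrac α (quot d)) (n : ℕ) :
    charWord α (den d n - 1) = lastLetter n := by
  have e := den_pos d n
  rw [charWord_eq, show ((den d n - 1 : ℕ) : ℤ) + 1 = den d n by omega, flo_den_succ hd hα,
    flo_den hα, lastLetter]
  split_ifs <;> simp_all

lemma pre_den (hd : ∀ i, 1 ≤ i → 1 ≤ d i) (hα : IsContFrac α (quot d)) :
    ∀ n, pre α (den d n) = stdAux d (n + 1)
  | 0 => by
    have := charWord_eq_a_of_le hα (hd 1 le_rfl)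
    simp [den, this, stdAux, pre, seg, ofWord]
  | 1 => by
    have h1 : ∀ m, m ≤ d 1 → pre α m = ltr Letter.a ^ m := by
      intro m
      induction m with
      | zero => intro _; simp [pre, seg, ofWord]
      | succ m ih =>
        intro hm
        rw [pre_succ, ih (by omega), charWord_eq_a_of_le hα (by omega), pow_succ]
    have h2 := charWord_den_sub_one hd hα 1
    simp only [den, lastLetter, Nat.add_sub_cancel] at h2
    simp [den, pre_succ, h1 _ le_rfl, h2, stdAux]
  | n + 2 => by
    have e := two_le_den hd n
    rw [den, pre_mul_den_add hd hα _ (by simp only [den]; omega), pre_den hd hα (n + 1),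
      pre_den hd hα n]
    rfl

/-- The prefix `s_n ℓ⁻¹`, where `ℓ` is the last letter of `s_n`. -/
def trunc (d : ℕ → ℕ) (n : ℕ) : FreeGroup Letter := stdAux d (n + 1) * (ltr (lastLetter n))⁻¹

lemma pre_den_sub_one (hd : ∀ i, 1 ≤ i → 1 ≤ d i) (hα : IsContFrac α (quot d)) (n : ℕ) :
    pre α (den d n - 1) = trunc d n := by
  have e := den_pos d n
  have := pre_succ α (den d n - 1)
  rw [Nat.sub_add_cancel e, pre_den hd hα, charWord_den_sub_one hd hα] at this
  rw [trunc, this, mul_inv_cancel_right]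

end

/-! ### Singular words in the free group -/

section

variable (d : ℕ → ℕ)

lemma sing_natCast (n : ℕ) : sing d n = ltr (lastLetter (n + 1)) * trunc d n := by
  have h1 : ¬ (n : ℤ) ≤ -2 := by omega
  have h2 : ¬ (n : ℤ) = -1 := by omega
  have h3 : ((n : ℤ) + 1).toNat = n + 1 := by omega
  rw [sing, if_neg h1, if_neg h2, std, h3, trunc]
  rcases Nat.even_or_odd n with hn | hn
  · simp [lastLetter, hn, Nat.even_add_one, mul_assoc]
  · simp [lastLetter, hn, mul_assoc, Nat.not_even_iff_odd.2 hn]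

/-- Since s_n^{d_{n+1}-1} s_{n-1} = s_n⁻¹ s_{n+1}, the product of the v_j telescopes. -/
lemma adj_natCast_sub_one (n : ℕ) : adj d ((n : ℤ) - 1) = (trunc d n)⁻¹ * trunc d (n + 1) := by
  have h1 : ¬ (n : ℤ) - 1 ≤ -2 := by omega
  have h2 : ((n : ℤ) - 1 + 2).toNat = n + 1 := by omega
  have h3 : ((n : ℤ) - 1 + 1 + 1).toNat = n + 1 := by omega
  have h4 : ((n : ℤ) - 1 + 1).toNat = n := by omega
  rw [adj, if_neg h1, std, std, h2, h3, h4, trunc, trunc, stdAux, zpow_sub_one, zpow_natCast]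
  have hc : stdAux d (n + 1) ^ d (n + 1) * (stdAux d (n + 1))⁻¹
      = (stdAux d (n + 1))⁻¹ * stdAux d (n + 1) ^ d (n + 1) :=
    ((Commute.refl _).pow_left _).inv_right
  rw [hc]
  rcases Nat.even_or_odd n with hn | hn
  · have ho : Odd ((n : ℤ) - 1) := by
      obtain ⟨r, hr⟩ := hn
      exact ⟨r - 1, by omega⟩
    simp [lastLetter, hn, ho, Nat.even_add_one, mul_assoc]
  · have ho : ¬ Odd ((n : ℤ) - 1) := by
      rw [Int.not_odd_iff_even]
      obtain ⟨r, hr⟩ := hn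
      exact ⟨r, by omega⟩
    simp only [lastLetter, ho, Nat.even_add_one, Nat.not_even_iff_odd.2 hn]
    simp [mul_assoc]

lemma trunc_zero : trunc d 0 = 1 := by simp [trunc, stdAux, lastLetter]

lemma adjProd_eq_trunc (n : ℕ) : adjProd d n = trunc d n := by
  induction n with
  | zero => simp [adjProd, trunc_zero]
  | succ n ih =>
    have : adjProd d (n + 1) = adjProd d n * adj d ((n : ℤ) - 1) := by
      simp [adjProd, List.range_succ]
    rw [this, ih, adj_natCast_sub_one, mul_inv_cancel_left]

lemma adj_mul_sing (n : ℕ) : adj d ((n : ℤ) - 1) * sing d n =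
    (trunc d n)⁻¹ * stdAux d (n + 2) * trunc d n := by
  rw [adj_natCast_sub_one, sing_natCast]
  simp [trunc, mul_assoc]

lemma sing_mul_adj (n : ℕ) : sing d n * adj d ((n : ℤ) - 1) =
    ltr (lastLetter (n + 1)) * stdAux d (n + 2) * (ltr (lastLetter (n + 1)))⁻¹ := by
  rw [adj_natCast_sub_one, sing_natCast]
  simp [trunc, mul_assoc]

lemma conj_inv_zpow {G : Type*} [Group G] (g h : G) (k : ℤ) :
    (g⁻¹ * h * g) ^ k = g⁻¹ * h ^ k * g := by
  simpa using conj_zpow (a := g⁻¹) (b := h) (i := k)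

lemma palUbar_eq (n : ℕ) (k : ℤ) : palUbar d ((n : ℤ) + 1) k =
    (trunc d n)⁻¹ * stdAux d (n + 2) ^ k * trunc d (n + 1) := by
  rw [palUbar, show (n : ℤ) + 1 - 2 = n - 1 by ring, add_sub_cancel_right, adj_mul_sing,
    conj_inv_zpow, adj_natCast_sub_one]
  group

lemma palU_eq (n : ℕ) : palU d n ((d (n + 1) : ℤ) - 2) =
    ltr (lastLetter n) * (stdAux d (n + 1))⁻¹ * (stdAux d (n + 1))⁻¹ * trunc d (n + 1) := by
  cases n with
  | zero =>
    -- Here w_{-1} = a and v_{-2} = ε, so only powers of a occur; the exponent may be -1.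
    have h : ∀ g : FreeGroup Letter, g ^ ((d 1 : ℤ) - 2) * g = g⁻¹ * g ^ d 1 := fun g => by
      rw [← zpow_natCast]; group
    simp [palU, sing, adj, trunc, stdAux, lastLetter, h]
  | succ n =>
    rw [palU, show ((n + 1 : ℕ) : ℤ) - 1 = n by push_cast; ring,
      show ((n + 1 : ℕ) : ℤ) - 2 = n - 1 by push_cast; ring, sing_mul_adj, conj_zpow,
      sing_natCast, trunc, trunc, stdAux.eq_3 d (n + 1), ← zpow_natCast,
      show lastLetter (n + 1 + 1) = lastLetter n by simp [lastLetter, Nat.even_add_one]]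
    group

lemma palUbar_mul_inv_palUbar (n : ℕ) (k : ℤ) :
    palUbar d ((n : ℤ) + 1) k * (palUbar d ((n : ℤ) + 1) (k - 1))⁻¹ =
      (trunc d n)⁻¹ * stdAux d (n + 2) * trunc d n := by
  rw [palUbar_eq, palUbar_eq]
  group

lemma palUbar_mul_inv_palU (n : ℕ) (k : ℤ) :
    palUbar d ((n : ℤ) + 1) k * (palU d n ((d (n + 1) : ℤ) - 2))⁻¹ =
      (trunc d n)⁻¹ * (stdAux d (n + 2) ^ k * stdAux d (n + 1)) * trunc d n := by
  rw [palUbar_eq, palU_eq]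
  simp [trunc, mul_assoc]

end

/-! ### Occurrences -/

lemma flo_succ_nonneg_le {β : ℝ} (h0 : 0 < β) (h1 : β < 1) (i : ℕ) :
    0 ≤ flo β (i + 1) ∧ flo β (i + 1) ≤ i := by
  have hi : (0 : ℝ) ≤ i := i.cast_nonneg
  constructor
  · apply Int.floor_nonneg.2; push_cast; positivity
  · rw [← Int.lt_add_one_iff, flo, Int.floor_lt]; push_cast; nlinarith

/-- The position reached after reading `i` letters of `c_β`, when the letters `a` and `b` advance
by `qu` and `qv`. -/
noncomputable def time (β : ℝ) (qu qv : ℤ) (i : ℕ) : ℤ :=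
  (i - flo β (i + 1)) * qu + flo β (i + 1) * qv

section

variable {β : ℝ} {qu qv : ℤ}

lemma time_zero (h0 : 0 < β) (h1 : β < 1) : time β qu qv 0 = 0 := by
  have h := flo_succ_nonneg_le h0 h1 0
  have : flo β ((0 : ℕ) + 1) = 0 := by push_cast at h ⊢; omega
  rw [time, this]
  simp

lemma time_succ_of_a {i : ℕ} (h : charWord β i = Letter.a) :
    time β qu qv (i + 1) = time β qu qv i + qu := by
  rw [charWord_eq_a_iff] at h
  simp only [time, Nat.cast_add, Nat.cast_one, h]
  ring

lemma time_succ_of_b (h0 : 0 < β) (h1 : β < 1) {i : ℕ} (h : charWord β i = Letter.b) :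
    time β qu qv (i + 1) = time β qu qv i + qv := by
  rw [charWord_eq_b_iff h0 h1] at h
  simp only [time, Nat.cast_add, Nat.cast_one, h]
  ring

lemma time_strictMono (h0 : 0 < β) (h1 : β < 1) (hu : 0 < qu) (hv : 0 < qv) :
    StrictMono (time β qu qv) := by
  refine strictMono_nat_of_lt_succ fun i => ?_
  cases h : charWord β i with
  | a => rw [time_succ_of_a h]; omega
  | b => rw [time_succ_of_b h0 h1 h]; omega

lemma time_nonneg (h0 : 0 < β) (h1 : β < 1) (hu : 0 < qu) (hv : 0 < qv) (i : ℕ) :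
    0 ≤ time β qu qv i := by
  rw [← time_zero h0 h1 (qu := qu) (qv := qv)]
  exact (time_strictMono h0 h1 hu hv).monotone i.zero_le

end

namespace IsApproxBasis

variable {α s μ ν : ℝ} {qu pu qv pv : ℤ}

lemma slope_pos (h : IsApproxBasis α s qu pu qv pv μ ν) : 0 < μ / (μ + ν) :=
  div_pos h.left_pos (add_pos h.left_pos h.right_pos)

lemma slope_lt_one (h : IsApproxBasis α s qu pu qv pv μ ν) : μ / (μ + ν) < 1 := by
  rw [div_lt_one (add_pos h.left_pos h.right_pos)]
  linarith [h.right_pos]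

/-- The value of the `i`-th time lies in the window. -/
lemma time_window (h : IsApproxBasis α s qu pu qv pv μ ν) (hu : 0 < qu) (hv : 0 < qv)
    (hirr : ∀ M : ℤ, 0 < M → ∀ r : ℤ, (M : ℝ) * α ≠ r) (i : ℕ) :
    -ν < s * (time (μ / (μ + ν)) qu qv i * α - time (μ / (μ + ν)) pu pv i) ∧
      s * (time (μ / (μ + ν)) qu qv i * α - time (μ / (μ + ν)) pu pv i) < μ := by
  have hB := flo_succ_nonneg_le h.slope_pos h.slope_lt_one i
  set B := flo (μ / (μ + ν)) (i + 1) with hBdef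
  simp only [time, ← hBdef]
  rw [h.eval]
  refine (h.window_iff ?_).2 ?_
  · intro hc
    have e := h.eval (i - B + 1) B
    have e2 : (B : ℝ) * ν - ((i - B + 1 : ℤ) : ℝ) * μ = 0 := by push_cast at hc ⊢; linarith
    have hs : s ≠ 0 := by rcases h.sign with hs | hs <;> rw [hs] <;> norm_num
    rw [e2, mul_eq_zero, or_iff_right hs, sub_eq_zero] at e
    refine hirr _ ?_ _ e
    have h1 : 0 < ((i : ℤ) - B + 1) * qu := mul_pos (by omega) hu
    have h2 : 0 ≤ B * qv := mul_nonneg hB.1 hv.le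
    omega
  · conv_lhs => rw [hBdef, flo]
    congr 3
    ring

/-- Every time greater than `-qu` whose value lies in the window is one of the times. -/
lemma exists_time_eq (h : IsApproxBasis α s qu pu qv pv μ ν) (hu : 0 < qu) (hv : 0 < qv)
    {t p : ℤ} (ht : -qu < t) (hw : -ν < s * (t * α - p) ∧ s * (t * α - p) < μ) :
    ∃ i : ℕ, t = time (μ / (μ + ν)) qu qv i := by
  obtain ⟨A, B, rfl, rfl⟩ := h.span t p
  rw [h.eval] at hw
  have hB := (h.window_iff hw.2.ne).1 hw
  have hμ := h.left_pos
  have hν := h.right_pos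
  -- If A + B < 0, the window forces A, B ≤ -1, whence t ≤ -qu - qv.
  have hnn : 0 ≤ A + B := by
    by_contra hc
    have hB0 : B ≤ -1 := by
      by_contra hc'
      have h1 : (0 : ℝ) ≤ B := by exact_mod_cast (by omega : 0 ≤ B)
      have h2 : (A : ℝ) ≤ -1 - B := by exact_mod_cast (by omega : A ≤ -1 - B)
      nlinarith
    have hA0 : A ≤ -1 := by
      by_contra hc'
      have h1 : (0 : ℝ) ≤ A := by exact_mod_cast (by omega : 0 ≤ A)
      have h2 : (B : ℝ) ≤ -1 := by exact_mod_cast hB0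
      nlinarith
    nlinarith
  obtain ⟨i, hi⟩ := Int.eq_ofNat_of_zero_le hnn
  refine ⟨i, ?_⟩
  have e : flo (μ / (μ + ν)) (i + 1) = B := by
    rw [hi] at hB
    exact hB.symm
  rw [time, e, ← hi]
  ring

end IsApproxBasis

lemma ncard_lt_of_strictMono {P : ℕ → Prop} {f : ℕ → ℕ} (hf : StrictMono f)
    (hP : ∀ m, P m ↔ ∃ i, m = f i) (i : ℕ) : {m : ℕ | m < f i ∧ P m}.ncard = i := by
  have : {m : ℕ | m < f i ∧ P m} = f '' (Finset.range i : Set ℕ) := by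
    ext m
    simp only [Set.mem_ofPred_eq, hP, Set.mem_image, Finset.coe_range, Set.mem_Iio]
    constructor
    · rintro ⟨h, j, rfl⟩; exact ⟨j, hf.lt_iff_lt.1 h, rfl⟩
    · rintro ⟨j, h, rfl⟩; exact ⟨hf h, j, rfl⟩
  rw [this, Set.ncard_image_of_injective _ hf.injective, Set.ncard_coe_finset, Finset.card_range]

section

variable {d : ℕ → ℕ} {α : ℝ}

/-- The slope governing the occurrences of `Ū_{n+1,k}`. -/
noncomputable def retSlope (d : ℕ → ℕ) (α : ℝ) (n k : ℕ) : ℝ :=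
  err d α (n + 1) / (err d α (n + 1) + (err d α n - k * err d α (n + 1)))

lemma isContFrac_retSlope (hα : IsContFrac α (quot d)) {n k : ℕ} (hk : k < d (n + 2)) :
    IsContFrac (retSlope d α n k) (shiftQuot (quot d) (n + 1) (1 - (k : ℤ))) := by
  have h := (hα.gaussIter (n + 1 + 1)).cons
    (a := quot d (n + 1) + (1 - k)) (by rw [quot_succ]; omega)
  have e1 : (fun i => if i = 0 then quot d (n + 1) + (1 - (k : ℤ)) else
      quot d (n + 1 + 1 + (i - 1))) = shiftQuot (quot d) (n + 1) (1 - (k : ℤ)) := by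
    funext i
    by_cases hi : i = 0
    · simp [shiftQuot, hi]
    · simp only [shiftQuot, hi, if_false]
      congr 1; omega
  rw [e1] at h
  convert h using 1
  have h1 := err_pos hα (n + 1)
  have h2 := err_succ hα (n + 1)
  have h3 := err_add_two d α n
  -- 1/β = 1 - k + err n / err (n+1), and the recursion turns the last quotient into d_{n+2} plus
  -- the next complete quotient.
  rw [retSlope, ← one_div_div, eq_comm]
  congr 1
  rw [eq_div_iff h1.ne', quot_succ]
  push_cast
  linear_combination h3 - h2

theorem isOccDecomp_palUbar (hd : ∀ i, 1 ≤ i → 1 ≤ d i) (hα : IsContFrac α (quot d)) {n k : ℕ}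
    (hk : k < d (n + 2)) :
    IsOccDecomp (charWord α) (adjProd d n) (palUbar d ((n : ℤ) + 1) k)
      (overAlphabet (charWord (retSlope d α n k)) (palUbar d ((n : ℤ) + 1) ((k : ℤ) - 1))⁻¹
        (palU d n ((d (n + 1) : ℤ) - 2))⁻¹) := by
  have h := isApproxBasis hα hk
  have hirr : ∀ M : ℤ, 0 < M → ∀ r : ℤ, (M : ℝ) * α ≠ r := by
    intro M hM r
    lift M to ℕ using hM.le
    exact hα.int_mul_ne M (by exact_mod_cast hM) r
  have hα0 := hα.pos
  have hα1 := hα.lt_one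
  have hN := den_pos d n
  have hlt := den_lt_den_succ hd n
  set N := den d n with hNdef
  set Q := den d (n + 1) with hQdef
  obtain ⟨V, hV⟩ : ∃ V, V = k * Q + N := ⟨_, rfl⟩
  have hVz : (k * Q + N : ℤ) = V := by rw [hV]; push_cast; ring
  rw [hVz] at h
  have hVN : N ≤ V := by rw [hV]; exact Nat.le_add_left _ _
  have hQ2 : Q ≤ den d (n + 2) := (den_lt_den_succ hd (n + 1)).le
  have hden : den d (n + 2) = d (n + 2) * Q + N := rfl
  have hkQ : k * Q + Q ≤ d (n + 2) * Q := by nlinarith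
  have hu : (0 : ℤ) < Q := by omega
  have hv : (0 : ℤ) < V := by omega
  have hμ := h.left_pos
  have hν := h.right_pos
  have hE2 := err_pos hα (n + 2)
  have hE2' := err_succ_lt hα (n + 1)
  have hE := err_add_two d α n
  have hkd : (k : ℝ) + 1 ≤ d (n + 2) := by exact_mod_cast hk
  have hμν : err d α (n + 1) < err d α n - k * err d α (n + 1) := by nlinarith
  have hμ1 : err d α (n + 1) < 1 := (err_le hα _).trans_lt hα1
  have hν1 : err d α n - k * err d α (n + 1) < 1 := by
    have : 0 ≤ (k : ℝ) * err d α (n + 1) := by positivity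
    linarith [err_le hα n]
  obtain ⟨μ, hμdef⟩ : ∃ μ, μ = err d α (n + 1) := ⟨_, rfl⟩
  obtain ⟨ν, hνdef⟩ : ∃ ν, ν = err d α n - k * err d α (n + 1) := ⟨_, rfl⟩
  rw [← hνdef, ← hμdef] at h hμν
  rw [← hμdef] at hμ hμ1
  rw [← hνdef] at hν hν1
  have hβ : retSlope d α n k = μ / (μ + ν) := by rw [retSlope, hμdef, hνdef]
  rw [hβ]
  have hβ0 := h.slope_pos
  have hβ1 := h.slope_lt_one
  have hwin := h.time_window hu hv hirr
  have hmono := time_strictMono hβ0 hβ1 hu hv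
  have hnn := time_nonneg hβ0 hβ1 hu hv
  have hsa := fun i => time_succ_of_a (β := μ / (μ + ν)) (qu := Q) (qv := V) (i := i)
  have hsb := fun i => time_succ_of_b (qu := Q) (qv := V) hβ0 hβ1 (i := i)
  have hsa' := fun i => time_succ_of_a (β := μ / (μ + ν)) (qu := num d (n + 1))
    (qv := k * num d (n + 1) + num d n) (i := i)
  have hsb' := fun i => time_succ_of_b (qu := num d (n + 1))
    (qv := k * num d (n + 1) + num d n) hβ0 hβ1 (i := i)
  have ht0 := time_zero hβ0 hβ1 (qu := Q) (qv := V)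
  generalize hβ' : μ / (μ + ν) = β at *
  obtain ⟨T, hT⟩ : ∃ T : ℕ → ℤ, T = time β Q V := ⟨_, rfl⟩
  obtain ⟨R, hR⟩ : ∃ R : ℕ → ℤ, R = time β (num d (n + 1)) (k * num d (n + 1) + num d n) :=
    ⟨_, rfl⟩
  simp only [← hT, ← hR] at hwin hmono hnn hsa hsb hsa' hsb' ht0
  -- the starting positions of the occurrences
  obtain ⟨f, hf⟩ : ∃ f : ℕ → ℕ, ∀ i, (f i : ℤ) = N - 1 + T i :=
    ⟨fun i => (N - 1 + T i).toNat, fun i => Int.toNat_of_nonneg (by have := hnn i; omega)⟩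
  have hfmono : StrictMono f := fun i j hij => by
    have := hmono hij; have := hf i; have := hf j; omega
  have hf0 : f 0 = N - 1 := by have := hf 0; omega
  -- L = (k+1) Q - N is the length of Ū_{n+1,k}.
  obtain ⟨L, hL⟩ : ∃ L, L + N + N = Q + V := ⟨Q + V - N - N, by omega⟩
  have hocc : ∀ m, OccursAt (charWord α) (seg (charWord α) (N - 1) L) m ↔ ∃ i, m = f i := by
    intro m
    rw [occursAt_seg_iff]
    constructor
    · intro hm
      rw [seg_charWord_eq_iff hα0 hα1] at hm
      have hN1 : ((N - 1 : ℕ) : ℤ) + 1 = N := by omega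
      rw [hN1] at hm
      obtain ⟨t, ht⟩ : ∃ t : ℤ, t = m + 1 - N := ⟨_, rfl⟩
      have hM : ∀ M : ℕ, N ≤ M → M ≤ N + L →
          ⌊((M + t : ℤ) : ℝ) * α⌋ - (flo α (m + 1) - flo α N) = ⌊((M : ℤ) : ℝ) * α⌋ := by
        intro M h1 h2
        have := hm (M - N) (by omega)
        rw [show (m : ℤ) + 1 + (M - N : ℕ) = M + t by omega,
          show (N : ℤ) + (M - N : ℕ) = M by omega] at this
        unfold flo at this ⊢
        omega
      -- Both Q and V lie in [N, N + L] = [N, Q + V - N], so the factor sees both basis vectors.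
      have hw := h.window_of_floor hμ1 hν1 (hM Q hlt.le (by omega)) (hM V hVN (by omega))
        (hirr _ (by omega) _) (hirr _ (by omega) _)
      -- A position m ≥ 0 gives t ≥ 1 - N > -Q, so no earlier return is missed.
      obtain ⟨i, hi⟩ := h.exists_time_eq hu hv (by omega) hw
      rw [hβ', ← hT] at hi
      exact ⟨i, by have := hf i; omega⟩
    · rintro ⟨i, rfl⟩
      refine seg_charWord_eq_of_flo hα0 hα1 (p := R i) (p' := 0) fun j hj => ?_
      have := h.floor_congr_window hu hv (M := N + j) (t := T i) (t' := 0) (p := R i) (p' := 0)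
        (by omega) (by omega) (hwin i) (by simp [hμ, hν])
      rw [show (f i : ℤ) + 1 + j = N + j + T i by have := hf i; omega,
        show ((N - 1 : ℕ) : ℤ) + 1 + j = N + j + 0 by omega]
      exact this
  -- the words between successive occurrences
  have hpN : pre α (N - 1) = trunc d n := pre_den_sub_one hd hα n
  have hpQ : pre α Q = stdAux d (n + 2) := pre_den hd hα (n + 1)
  have hgapa : ∀ i, charWord β i = Letter.a → pre α (f (i + 1)) =
      pre α (f i) * ((trunc d n)⁻¹ * stdAux d (n + 2) * trunc d n) := by
    intro i hi
    have e : f (i + 1) = f i + Q := by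
      have := hf i; have := hf (i + 1); have := hsa i hi; omega
    -- The next time is again in the window, so the value at `T i` exceeds μ - ν, as does 0 because
    -- μ < ν. The bound M ≤ Q + V is attained when k = 0, where the gap is longer than the factor.
    have hs : seg (charWord α) (f i) Q = seg (charWord α) (N - 1) Q := by
      refine seg_charWord_eq_of_flo hα0 hα1 (p := R i) (p' := 0) fun j hj => ?_
      have hw := (hwin (i + 1)).1
      rw [hsa i hi, hsa' i hi] at hw
      have hl := h.left
      push_cast at hw hl
      have := h.floor_congr_left hu hv (M := N + j) (t := T i) (t' := 0) (p := R i) (p' := 0)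
        (by omega) (by omega) ⟨by linarith, (hwin i).2⟩ (by simp [hμ, hμν])
      rw [show (f i : ℤ) + 1 + j = N + j + T i by have := hf i; omega,
        show ((N - 1 : ℕ) : ℤ) + 1 + j = N + j + 0 by omega]
      exact this
    rw [e, pre, seg_add, ofWord_append, zero_add, hs, ofWord_seg _ (N - 1)]
    change pre α (f i) * ((pre α (N - 1))⁻¹ * pre α (N - 1 + Q)) = _
    rw [hpN, add_comm (N - 1) Q, pre_den_add hd hα (by rw [hden]; omega), hpQ, hpN, mul_assoc]
  have hgapb : ∀ i, charWord β i = Letter.b → pre α (f (i + 1)) =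
      pre α (f i) * ((trunc d n)⁻¹ * (stdAux d (n + 2) ^ (k : ℤ) * stdAux d (n + 1)) *
        trunc d n) := by
    intro i hi
    have e : f (i + 1) = f i + V := by
      have := hf i; have := hf (i + 1); have := hsb i hi; omega
    -- The comparison time is c Q: its value -c μ = -ν + err (n+2) lies in (-ν, μ - ν), and a step V
    -- leads from it to c Q + V = q_{n+2}, where the prefix is known.
    obtain ⟨c, hc⟩ : ∃ c, d (n + 2) = k + c := ⟨d (n + 2) - k, by omega⟩
    have hcQ : c * Q + V = den d (n + 2) := by rw [hden, hc, hV]; ring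
    have hs : seg (charWord α) (f i) V = seg (charWord α) (c * Q + (N - 1)) V := by
      refine seg_charWord_eq_of_flo hα0 hα1 (p := R i) (p' := c * num d (n + 1)) fun j hj => ?_
      have hw := (hwin (i + 1)).2
      rw [hsb i hi, hsb' i hi] at hw
      have hr := h.right
      push_cast at hw hr
      have hcv := h.eval c 0
      simp only [zero_mul, add_zero, Int.cast_zero, zero_sub] at hcv
      have hcμ : (c : ℝ) * μ = ν - err d α (n + 2) := by
        rw [hE, hc, hμdef, hνdef]; push_cast; ring
      rw [← hμdef] at hE2'
      have := h.floor_congr_right hu hv (M := N + j) (t := T i) (t' := c * Q) (p := R i)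
        (p' := c * num d (n + 1))
        (by omega) (by omega) ⟨(hwin i).1, by linarith⟩ (by
          rw [hcv]; push_cast; constructor <;> linarith)
      rw [show (f i : ℤ) + 1 + j = N + j + T i by have := hf i; omega,
        show ((c * Q + (N - 1) : ℕ) : ℤ) + 1 + j = N + j + c * Q by push_cast; omega]
      exact this
    rw [e, pre, seg_add, ofWord_append, zero_add, hs, ofWord_seg _ (c * Q + (N - 1))]
    change pre α (f i) * ((pre α (c * Q + (N - 1)))⁻¹ * pre α (c * Q + (N - 1) + V)) = _
    have hdlt := den_lt_den_succ hd (n + 2)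
    have hcc : d (n + 2) * Q = k * Q + c * Q := by rw [hc]; ring
    rw [show c * Q + (N - 1) + V = den d (n + 2) + (N - 1) by omega,
      pre_den_add hd hα (by omega), pre_den hd hα,
      pre_mul_den_add hd hα c (by rw [← hQdef, hden]; omega), ← hQdef, hpQ, hpN,
      stdAux.eq_3 d (n + 1), hc, zpow_natCast, add_comm k c, pow_add]
    group
  -- assembling
  refine ⟨seg (charWord α) (N - 1) L, ?_, fun i => ⟨seg (charWord α) 0 (f i), ?_, ?_, ?_⟩⟩
  · rw [ofWord_seg, palUbar_eq]
    change (pre α (N - 1))⁻¹ * pre α (N - 1 + L) = _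
    have e : N - 1 + L = k * Q + (Q - 1) := by rw [hV] at hL; omega
    rw [hpN, e, pre_mul_den_add hd hα k (by rw [← hQdef, hden]; omega), ← hQdef, hpQ,
      pre_den_sub_one hd hα, zpow_natCast, mul_assoc]
  · change pre α (f i) = _
    rw [adjProd_eq_trunc]
    induction i with
    | zero => simp [hf0, hpN]
    | succ i ih =>
      rw [List.range_succ, List.map_append, List.prod_append, ← mul_assoc, ← ih]
      simp only [List.map_cons, List.map_nil, List.prod_singleton, overAlphabet]
      cases hi : charWord β i with
      | a => simp only [palUbar_mul_inv_palUbar, hgapa i hi]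
      | b => simp only [palUbar_mul_inv_palU, hgapb i hi]
  · have := (occursAt_seg_iff (charWord α) (f i) (N - 1) L).1 ((hocc _).2 ⟨i, rfl⟩)
    have e : seg (charWord α) 0 (f i) ++ seg (charWord α) (N - 1) L =
        seg (charWord α) 0 (f i + L) := by rw [seg_add, zero_add, this]
    rw [e, occursAt_seg_iff]
  · rw [length_seg]
    exact ncard_lt_of_strictMono hfmono hocc i

end

end Sturmian

theorem mainTheorem6 (d : ℕ → ℕ) (hd : ∀ i, 1 ≤ i → 1 ≤ d i)
    (α : ℝ) (hα : Sturmian.IsContFrac α (Sturmian.quot d))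
    (n : ℕ) (hn : 1 ≤ n) (k : ℕ) (hk : k ≤ d (n + 1) - 1) :
    ∃ β : ℝ, Sturmian.IsContFrac β (Sturmian.shiftQuot (Sturmian.quot d) n (1 - (k : ℤ))) ∧
      Sturmian.IsOccDecomp (Sturmian.charWord α)
        (Sturmian.adjProd d (n - 1))
        (Sturmian.palUbar d n k)
        (Sturmian.overAlphabet (Sturmian.charWord β)
          (Sturmian.palUbar d n ((k : ℤ) - 1))⁻¹
          (Sturmian.palU d ((n : ℤ) - 1) ((d n : ℤ) - 2))⁻¹) := by
  obtain ⟨m, rfl⟩ : ∃ m, n = m + 1 := ⟨n - 1, by omega⟩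
  -- The subtraction in `hk` is truncated; d (m + 2) ≥ 1 makes the bound strict.
  have hk' : k < d (m + 2) := by
    have := hd (m + 2) (by omega)
    have : k ≤ d (m + 2) - 1 := hk
    omega
  refine ⟨Sturmian.retSlope d α m k, Sturmian.isContFrac_retSlope hα hk', ?_⟩
  have := Sturmian.isOccDecomp_palUbar hd hα hk'
  simpa using this
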